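/- Let $S^2\subset\mathbb R^3$ be the unit sphere with its standard Riemannian metric, and let $$\mathbb C=\coprod_{p\in S^2} L^2([0,1],T_pS^2),$$ a Hilbert vector bundle over $S^2$ (smooth as a submanifold of $\mathbb R^3\times L^2([0,1],\mathbb R^3)$), with fibres $\mathbb C_p=L^2([0,1],T_pS^2)$. Identify $T_{(x,v)}\mathbb C\cong T_xS^2\oplus\mathbb C_x$ so that the velocity of a smooth path $(\beta(s),q(s,\cdot))$ in $\mathbb C$ is $(\beta_s,\nabla_{\beta_s}q)$, where $\beta_s=\dot\beta(s)$ and $\nabla_{\beta_s}$ is covariant differentiation along $\beta$ (for each $t$, the orthogonal projection to $T_{\beta(s)}S^2$ of the $s$-derivative, the derivative being taken in $L^2$). Give $\mathbb C$ the Riemannian metric $$\langle(u_1,w_1),(u_2,w_2)\rangle=u_1\cdot u_2+\int_0^1 w_1(t)\cdot w_2(t)\,dt .$$ Let $(\beta(s),q(s,\cdot))$, $s\in[0,1]$, be a geodesic in $\mathbb C$ for this metric, that is, a smooth path that is a critical point of the energy $\frac12\int_0^1\big(|\dot\beta(s)|^2+\int_0^1|\nabla_{\beta_s}q(s,t)|^2dt\big)ds$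 among smooth variations with fixed end points. Then: 1. the base curve $\beta$ has constant speed: $|\dot\beta(s)|$ is the same for all $s\in[0,1]$; 2. $q$ is covariantly linear along $\beta$: $\nabla_{\beta_s}(\nabla_{\beta_s}q(s,\cdot))=0$ in $L^2([0,1],T_{\beta(s)}S^2)$ for every $s\in[0,1]$. -/

import Mathlib

open MeasureTheory Set
open scoped ContDiff

noncomputable section

namespace SphereBundle

/-- The ambient Euclidean space `ℝ³`. -/
abbrev E3 : Type := EuclideanSpace ℝ (Fin 3)

/-- The unit sphere `S² ⊆ ℝ³`. -/
abbrev S2 : Type := Metric.sphere (0 : E3) 1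

/-- The tangent plane `T_p S² = p^⊥ ⊆ ℝ³`, with the inner product inherited from `ℝ³`
(the standard Riemannian metric of the sphere). -/
abbrev TangentPlane (p : S2) : Submodule ℝ E3 := (Submodule.span ℝ {(p : E3)})ᗮ

/-- Lebesgue measure on `[0,1]`. -/
abbrev unitMeasure : Measure ℝ := volume.restrict (Icc (0 : ℝ) 1)

/-- The fibre `ℂ_p = L²([0,1], T_p S²)`. -/
abbrev Fiber (p : S2) : Type := Lp (TangentPlane p) 2 unitMeasure

/-- The ambient Hilbert space `L²([0,1], ℝ³)`. -/
abbrev AmbientL2 : Type := Lp E3 2 unitMeasure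

/-- The total space `ℂ = ⊔ₚ L²([0,1], T_p S²)`. -/
abbrev BundleC : Type := Σ p : S2, Fiber p

/-- The inclusion `L²([0,1], T_p S²) → L²([0,1], ℝ³)` induced by `T_p S² ⊆ ℝ³`. -/
def fiberIncl (p : S2) : Fiber p →L[ℝ] AmbientL2 :=
  ContinuousLinearMap.compLpL 2 unitMeasure (TangentPlane p).subtypeL

/-- The map `L²([0,1], ℝ³) → L²([0,1], T_p S²)` that applies the orthogonal projection
`ℝ³ → T_p S²` to each value. -/
def fiberProj (p : S2) : AmbientL2 →L[ℝ] Fiber p :=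
  ContinuousLinearMap.compLpL 2 unitMeasure (TangentPlane p).orthogonalProjectionOnto

/-- The tangent space `T_{(x,v)} ℂ = T_x S² ⊕ ℂ_x`. -/
abbrev TangentC (z : BundleC) : Type := TangentPlane z.1 × Fiber z.1

/-- The Riemannian metric of `ℂ`:
`⟨(u₁,w₁),(u₂,w₂)⟩ = u₁ ⬝ u₂ + ∫₀¹ w₁(t) ⬝ w₂(t) dt`. -/
def metricC (z : BundleC) (X Y : TangentC z) : ℝ :=
  inner ℝ X.1 Y.1 + ∫ t, inner ℝ (X.2 t) (Y.2 t) ∂unitMeasure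

/-- The velocity `β'(s) ∈ T_{β(s)} S²`, for `s ∈ [0,1]` (one-sided at the end points).
Where `β` is differentiable, its derivative in `ℝ³` is already tangent to the sphere, so that the
projection changes nothing; it only makes the value an element of the tangent plane. -/
def baseVelocity (β : ℝ → S2) (s : ℝ) : TangentPlane (β s) :=
  (TangentPlane (β s)).orthogonalProjectionOnto
    (derivWithin (fun r => (β r : E3)) (Icc 0 1) s)

/-- The covariant derivative `∇_{β_s} V` along a base curve `β` in `S²` of a field
`V(s,·) ∈ L²([0,1], T_{β(s)} S²)`: the tangential part, for each `t`, of the derivative in `s`. -/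
def covDeriv (β : ℝ → S2) (V : (s : ℝ) → Fiber (β s)) (s : ℝ) : Fiber (β s) :=
  fiberProj (β s) (derivWithin (fun r => fiberIncl (β r) (V r)) (Icc 0 1) s)

/-- The base curve `β` of a path in `ℂ`. -/
abbrev baseCurve (γ : ℝ → BundleC) (s : ℝ) : S2 := (γ s).1

/-- The fibre part `q(s,·)` of a path in `ℂ`. -/
abbrev fiberPart (γ : ℝ → BundleC) (s : ℝ) : Fiber (baseCurve γ s) := (γ s).2

/-- The velocity `(β_s, ∇_{β_s} q) ∈ T_{β(s)} S² ⊕ ℂ_{β(s)}` of a path `(β, q)` in `ℂ`. -/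
def velocity (γ : ℝ → BundleC) (s : ℝ) : TangentC (γ s) :=
  (baseVelocity (baseCurve γ) s, covDeriv (baseCurve γ) (fiberPart γ) s)

/-- The energy `½ ∫₀¹ ⟨γ'(s), γ'(s)⟩ ds` of a path over `[0,1]` in `ℂ`. -/
def energy (γ : ℝ → BundleC) : ℝ :=
  (1 / 2) * ∫ s in (0 : ℝ)..1, metricC (γ s) (velocity γ s) (velocity γ s)

/-- The embedding of `ℂ` as a submanifold of the Hilbert space `ℝ³ × L²([0,1], ℝ³)`, which carries
its smooth structure (but not its metric). -/
def ambient (z : BundleC) : E3 × AmbientL2 := ((z.1 : E3), fiberIncl z.1 z.2)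

/-- A smooth path `[0,1] → ℂ`; the values of `γ` outside `[0,1]` play no role. -/
def IsSmoothPath (γ : ℝ → BundleC) : Prop :=
  ContDiffOn ℝ ∞ (fun s => ambient (γ s)) (Icc 0 1)

/-- A smooth variation `(-δ,δ) × [0,1] → ℂ`, `(ε, s) ↦ Γ ε s`, of the path `γ` with fixed end
points. -/
structure IsVariation (γ : ℝ → BundleC) (δ : ℝ) (Γ : ℝ → ℝ → BundleC) : Prop where
  pos : 0 < δ
  smooth : ContDiffOn ℝ ∞ (fun x : ℝ × ℝ => ambient (Γ x.1 x.2)) (Ioo (-δ) δ ×ˢ Icc 0 1)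
  center : ∀ s ∈ Icc (0 : ℝ) 1, Γ 0 s = γ s
  left : ∀ ε ∈ Ioo (-δ) δ, Γ ε 0 = γ 0
  right : ∀ ε ∈ Ioo (-δ) δ, Γ ε 1 = γ 1

/-- A geodesic `[0,1] → ℂ` of the Riemannian metric `metricC`: a smooth path that is a critical
point of the energy with respect to all smooth variations with fixed end points. -/
structure IsGeodesic (γ : ℝ → BundleC) : Prop where
  smooth : IsSmoothPath γ
  critical : ∀ (δ : ℝ) (Γ : ℝ → ℝ → BundleC), IsVariation γ δ Γ →
    HasDerivAt (fun ε => energy (Γ ε)) 0 0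

end SphereBundle

end

/-! Two explicit families of variations suffice; no Euler–Lagrange equation for the base curve,
hence no curvature term, is needed. Vertical: keep `β` and move `q` to `q + εW`. The energy is a
quadratic polynomial in `ε` with linear coefficient `∫⟨∇q, ∇W⟩`, which therefore vanishes
(`IsGeodesic.integral_inner_covDeriv_eq_zero`). Taking `W = s(1-s)∇∇q` and integrating by parts
gives `∫ s(1-s)‖∇∇q‖² = 0`, so `∇∇q = 0`. Metric compatibility then makes `‖∇q‖` constant.
Horizontal in time: reparametrise by `s + εη(s)`. Criticality under these inner variations forces
the full density `e = |β'|² + ‖∇q‖²` to be constant (`IsGeodesic.metricC_velocity_eq`). Subtracting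
`‖∇q‖²` leaves `|β'|²` constant. Everything is computed in `ℝ³` and `L²([0,1], ℝ³)`, with `∇` as
projection after differentiation. -/

namespace SphereBundle

/-! ### Orthogonal projections in the ambient Hilbert spaces -/

/-- The map `v ↦ v - ⟨p, v⟩ p`, the orthogonal projection to `p^⊥` when `p` is a unit vector. -/
noncomputable def tangentProj (p : E3) : E3 →L[ℝ] E3 :=
  ContinuousLinearMap.id ℝ E3 - (innerSL ℝ p).smulRight p

/-- The action of `tangentProj p` on the values of a square integrable field. -/
noncomputable def fieldProj (p : E3) : AmbientL2 →L[ℝ] AmbientL2 :=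
  ContinuousLinearMap.compLpL 2 unitMeasure (tangentProj p)

theorem tangentProj_apply (p v : E3) : tangentProj p v = v - inner ℝ p v • p := by
  simp [tangentProj]

theorem coe_orthogonalProjectionOnto (p : S2) (v : E3) :
    ((TangentPlane p).orthogonalProjectionOnto v : E3) = tangentProj p v := by
  have hp : ‖(p : E3)‖ = 1 := by simp
  rw [tangentProj_apply, ← Submodule.starProjection_unit_singleton ℝ hp v,
    ← Submodule.starProjection_orthogonal_val, Submodule.starProjection_apply]

theorem inner_tangentProj_left (p v w : E3) :
    inner ℝ (tangentProj p v) w = inner ℝ v (tangentProj p w) := by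
  simp only [tangentProj_apply, inner_sub_left, inner_sub_right, real_inner_smul_left,
    real_inner_smul_right, real_inner_comm p v]
  ring

theorem contDiff_tangentProj : ContDiff ℝ ∞ tangentProj := by
  unfold tangentProj
  exact contDiff_const.sub (((innerSL ℝ).contDiff).smulRight contDiff_id)

/-- Composition on `L²` depends linearly and continuously on the operator applied, and `tangentProj
p` is quadratic in `p`. Letting `p` range over all of `ℝ³` keeps this a statement about maps of
vector spaces. -/
theorem contDiff_fieldProj : ContDiff ℝ ∞ fieldProj := by
  have h : fieldProj = fun p => (ContinuousLinearMap.id ℝ (E3 →L[ℝ] E3)).compLpL₂ 2 unitMeasure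
      (tangentProj p) := by
    ext1 p
    ext1 f
    simp [fieldProj]
    rfl
  rw [h]
  exact (ContinuousLinearMap.contDiff _).comp contDiff_tangentProj

theorem fiberIncl_fiberProj (p : S2) (f : AmbientL2) :
    fiberIncl p (fiberProj p f) = fieldProj p f := by
  apply Lp.ext
  filter_upwards [ContinuousLinearMap.coeFn_compLpL (p := 2) (μ := unitMeasure)
      (TangentPlane p).subtypeL (fiberProj p f),
    ContinuousLinearMap.coeFn_compLpL (p := 2) (μ := unitMeasure)
      (TangentPlane p).orthogonalProjectionOnto f,
    ContinuousLinearMap.coeFn_compLpL (p := 2) (μ := unitMeasure) (tangentProj p) f]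
    with t h₁ h₂ h₃
  rw [fiberIncl, fieldProj, h₁, h₃, fiberProj, h₂]
  exact coe_orthogonalProjectionOnto p (f t)

theorem fiberProj_fiberIncl (p : S2) (v : Fiber p) : fiberProj p (fiberIncl p v) = v := by
  apply Lp.ext
  filter_upwards [ContinuousLinearMap.coeFn_compLpL (p := 2) (μ := unitMeasure)
      (TangentPlane p).subtypeL v,
    ContinuousLinearMap.coeFn_compLpL (p := 2) (μ := unitMeasure)
      (TangentPlane p).orthogonalProjectionOnto (fiberIncl p v)]
    with t h₁ h₂
  rw [fiberProj, h₂, fiberIncl, h₁]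
  exact Submodule.orthogonalProjectionOnto_mem_subspace_eq_self (v t)

theorem fieldProj_fiberIncl (p : S2) (v : Fiber p) :
    fieldProj p (fiberIncl p v) = fiberIncl p v := by
  rw [← fiberIncl_fiberProj, fiberProj_fiberIncl]

theorem fiberIncl_injective (p : S2) : Function.Injective (fiberIncl p) :=
  Function.LeftInverse.injective (fiberProj_fiberIncl p)

theorem inner_fieldProj_left (p : E3) (f g : AmbientL2) :
    inner ℝ (fieldProj p f) g = inner ℝ f (fieldProj p g) := by
  rw [L2.inner_def, L2.inner_def]
  apply integral_congr_ae
  filter_upwards [ContinuousLinearMap.coeFn_compLpL (p := 2) (μ := unitMeasure) (tangentProj p) f,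
    ContinuousLinearMap.coeFn_compLpL (p := 2) (μ := unitMeasure) (tangentProj p) g] with t h₁ h₂
  rw [fieldProj, h₁, h₂, inner_tangentProj_left]

theorem integral_inner_self_fiber (p : S2) (v : Fiber p) :
    ∫ t, inner ℝ (v t) (v t) ∂unitMeasure = ‖fiberIncl p v‖ ^ 2 := by
  rw [← real_inner_self_eq_norm_sq, L2.inner_def]
  apply integral_congr_ae
  filter_upwards [ContinuousLinearMap.coeFn_compLpL (p := 2) (μ := unitMeasure)
      (TangentPlane p).subtypeL v] with t h
  rw [fiberIncl, h]
  rfl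

theorem fiberIncl_covDeriv (β : ℝ → S2) (V : (s : ℝ) → Fiber (β s)) (s : ℝ) :
    fiberIncl (β s) (covDeriv β V s) =
      fieldProj (β s) (derivWithin (fun r => fiberIncl (β r) (V r)) (Icc 0 1) s) :=
  fiberIncl_fiberProj _ _

/-- The energy density of a path, computed in the ambient Hilbert space. -/
theorem metricC_velocity (γ : ℝ → BundleC) (s : ℝ) :
    metricC (γ s) (velocity γ s) (velocity γ s) =
      ‖tangentProj (γ s).1 (derivWithin (fun r => ((γ r).1 : E3)) (Icc 0 1) s)‖ ^ 2 +
      ‖fieldProj (γ s).1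
        (derivWithin (fun r => fiberIncl (γ r).1 (γ r).2) (Icc 0 1) s)‖ ^ 2 := by
  have h₁ : ‖(velocity γ s).1‖ = ‖tangentProj (γ s).1
      (derivWithin (fun r => ((γ r).1 : E3)) (Icc 0 1) s)‖ := by
    rw [← coe_orthogonalProjectionOnto]
    rfl
  have h₂ : fiberIncl (γ s).1 (velocity γ s).2 = fieldProj (γ s).1
      (derivWithin (fun r => fiberIncl (γ r).1 (γ r).2) (Icc 0 1) s) :=
    fiberIncl_covDeriv (baseCurve γ) (fiberPart γ) s
  rw [metricC, integral_inner_self_fiber, real_inner_self_eq_norm_sq, h₁, h₂]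

end SphereBundle

/-! ### Calculus on the unit interval -/

section Calculus

variable {H : Type*} [NormedAddCommGroup H] [InnerProductSpace ℝ H]

/-- The Leibniz rule for the inner product of two sections of a family of subspaces, given by
orthogonal projections `P s`: only the tangential parts of the derivatives enter. -/
theorem hasDerivWithinAt_inner_of_proj {P : H →L[ℝ] H}
    (hP : ∀ f g, inner ℝ (P f) g = inner ℝ f (P g)) {V W : ℝ → H} {V' W' : H} {I : Set ℝ} {s : ℝ}
    (hV : HasDerivWithinAt V V' I s) (hW : HasDerivWithinAt W W' I s)
    (hPV : P (V s) = V s) (hPW : P (W s) = W s) :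
    HasDerivWithinAt (fun r => inner ℝ (V r) (W r))
      (inner ℝ (V s) (P W') + inner ℝ (P V') (W s)) I s := by
  rw [hP, hPW, ← hP, hPV]
  exact hV.inner ℝ hW

theorem integral_derivWithin_eq_zero {f : ℝ → ℝ} (hf : ContDiffOn ℝ ∞ f (Icc 0 1))
    (h₀ : f 0 = 0) (h₁ : f 1 = 0) : ∫ s in (0 : ℝ)..1, derivWithin f (Icc 0 1) s = 0 := by
  rw [intervalIntegral.integral_derivWithin_Icc_of_contDiffOn_Icc
    (hf.of_le (by exact_mod_cast le_top)) zero_le_one, h₀, h₁, sub_zero]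

theorem contDiffOn_derivWithin_Icc {F : Type*} [NormedAddCommGroup F] [NormedSpace ℝ F]
    {f : ℝ → F} (hf : ContDiffOn ℝ ∞ f (Icc 0 1)) :
    ContDiffOn ℝ ∞ (derivWithin f (Icc 0 1)) (Icc 0 1) :=
  hf.derivWithin (uniqueDiffOn_Icc zero_lt_one) (by simp)

theorem ContDiffOn.hasDerivWithinAt_Icc {F : Type*} [NormedAddCommGroup F] [NormedSpace ℝ F]
    {f : ℝ → F} (hf : ContDiffOn ℝ ∞ f (Icc 0 1)) {s : ℝ} (hs : s ∈ Icc (0 : ℝ) 1) :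
    HasDerivWithinAt f (derivWithin f (Icc 0 1) s) (Icc 0 1) s :=
  (hf.differentiableOn (by simp) s hs).hasDerivWithinAt

/-- A continuous function on `[0,1]` whose square has zero integral against `s (1 - s)` is zero. -/
theorem eq_zero_of_integral_bump_mul_sq {F : Type*} [NormedAddCommGroup F] {f : ℝ → F}
    (hf : ContinuousOn f (Icc 0 1)) (h : ∫ s in (0 : ℝ)..1, s * (1 - s) * ‖f s‖ ^ 2 = 0) :
    ∀ s ∈ Icc (0 : ℝ) 1, f s = 0 := by
  have hg : ContinuousOn (fun s : ℝ => s * (1 - s) * ‖f s‖ ^ 2) (Icc 0 1) := by fun_prop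
  have h₀ : EqOn (fun s : ℝ => f s) (fun _ => 0) (Ioo 0 1) := by
    intro c hc
    by_contra hne
    have hpos : 0 < ∫ s in (0 : ℝ)..1, s * (1 - s) * ‖f s‖ ^ 2 := by
      refine intervalIntegral.integral_pos zero_lt_one hg ?_ ⟨c, ⟨hc.1.le, hc.2.le⟩, ?_⟩
      · intro x hx
        have h₁ : 0 ≤ 1 - x := by linarith [hx.2]
        have h₂ : 0 ≤ x := hx.1.le
        positivity
      · have h₁ : 0 < 1 - c := by linarith [hc.2]
        have h₂ : 0 < c := hc.1
        have h₃ : 0 < ‖f c‖ := norm_pos_iff.mpr hne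
        positivity
    exact hpos.ne' h
  have hcl : Icc (0 : ℝ) 1 ⊆ closure (Ioo 0 1) := by rw [closure_Ioo zero_ne_one]
  -- The weight vanishes at the end points, so these are reached by continuity.
  exact h₀.of_subset_closure hf continuousOn_const Ioo_subset_Icc_self hcl

theorem eq_of_derivWithin_Icc_eq_zero {f : ℝ → ℝ} (hf : DifferentiableOn ℝ f (Icc 0 1))
    (h : ∀ s ∈ Icc (0 : ℝ) 1, derivWithin f (Icc 0 1) s = 0) {s : ℝ} (hs : s ∈ Icc (0 : ℝ) 1) :
    f s = f 0 :=
  constant_of_derivWithin_zero hf (fun x hx => h x (Ico_subset_Icc_self hx)) s hs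

/-- Small multiples of `s (1 - s) k(s)` move no point of `[0,1]` out of it, and no interior point
to the boundary. -/
theorem exists_reparam_mapsTo {k : ℝ → ℝ} (hk : ContinuousOn k (Icc 0 1)) :
    ∃ δ > 0, ∀ ε ∈ Ioo (-δ) δ,
      (∀ s ∈ Icc (0 : ℝ) 1, s + ε * (s * (1 - s) * k s) ∈ Icc (0 : ℝ) 1) ∧
      ∀ s ∈ Ioo (0 : ℝ) 1, s + ε * (s * (1 - s) * k s) ∈ Ioo (0 : ℝ) 1 := by
  obtain ⟨M, hM⟩ := isCompact_Icc.exists_bound_of_continuousOn hk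
  have hM₀ : 0 ≤ M := (norm_nonneg _).trans (hM 0 (by simp))
  -- With `|ε k| < 1` the displacement is at most `s(1-s)`, which does not exceed the distance from
  -- `s` to either end point. The `+ 1` covers `M = 0`.
  have key : ∀ ε ∈ Ioo (-(1 / (M + 1))) (1 / (M + 1)), ∀ s ∈ Icc (0 : ℝ) 1, |ε * k s| < 1 := by
    intro ε hε s hs
    have h₁ : |ε| < 1 / (M + 1) := abs_lt.mpr hε
    have h₂ : |k s| ≤ M := hM s hs
    rw [abs_mul]
    calc |ε| * |k s| ≤ |ε| * (M + 1) := by gcongr; linarith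
      _ < 1 / (M + 1) * (M + 1) := by gcongr
      _ = 1 := by field_simp
  refine ⟨1 / (M + 1), by positivity, fun ε hε => ⟨fun s hs => ?_, fun s hs => ?_⟩⟩
  · obtain ⟨h₁, h₂⟩ := abs_lt.mp (key ε hε s hs)
    obtain ⟨h₃, h₄⟩ := hs
    have h₅ : 0 ≤ s * (1 - s) := mul_nonneg h₃ (by linarith)
    constructor <;> nlinarith
  · obtain ⟨h₁, h₂⟩ := abs_lt.mp (key ε hε s ⟨hs.1.le, hs.2.le⟩)
    obtain ⟨h₃, h₄⟩ := hs
    have h₅ : 0 < s * (1 - s) := mul_pos h₃ (by linarith)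
    constructor <;> nlinarith

/-- First variation of the energy `∫ e ψ'²` under the reparametrisation `ψ(s) = s + ε η(s)`. -/
theorem hasDerivAt_integral_reparam {e η : ℝ → ℝ} (he : ContDiffOn ℝ ∞ e (Icc 0 1))
    (hη : ContDiffOn ℝ ∞ η (Icc 0 1)) {δ : ℝ} (hδ : 0 < δ)
    (hmaps : ∀ ε ∈ Ioo (-δ) δ, (∀ s ∈ Icc (0 : ℝ) 1, s + ε * η s ∈ Icc (0 : ℝ) 1) ∧
      ∀ s ∈ Ioo (0 : ℝ) 1, s + ε * η s ∈ Ioo (0 : ℝ) 1) :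
    HasDerivAt (fun ε => ∫ s in (0 : ℝ)..1,
        (1 + ε * derivWithin η (Icc 0 1) s) ^ 2 * e (s + ε * η s))
      (∫ s in (0 : ℝ)..1, (2 * derivWithin η (Icc 0 1) s * e s +
        derivWithin e (Icc 0 1) s * η s)) 0 := by
  have hηd := (contDiffOn_derivWithin_Icc hη).continuousOn
  have hed := (contDiffOn_derivWithin_Icc he).continuousOn
  set η' := derivWithin η (Icc 0 1) with hη'
  set e' := derivWithin e (Icc 0 1) with he'
  obtain ⟨A, hA⟩ := isCompact_Icc.exists_bound_of_continuousOn he.continuousOn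
  obtain ⟨A', hA'⟩ := isCompact_Icc.exists_bound_of_continuousOn hed
  obtain ⟨B, hB⟩ := isCompact_Icc.exists_bound_of_continuousOn hη.continuousOn
  obtain ⟨B', hB'⟩ := isCompact_Icc.exists_bound_of_continuousOn hηd
  have hcont : ∀ ε ∈ Ioo (-δ) δ,
      ContinuousOn (fun s => (1 + ε * η' s) ^ 2 * e (s + ε * η s)) (Icc 0 1) := by
    intro ε hε
    have hψ : ContinuousOn (fun s => s + ε * η s) (Icc 0 1) :=
      continuousOn_id.add (continuousOn_const.mul hη.continuousOn)
    exact ((continuousOn_const.add (continuousOn_const.mul hηd)).pow 2).mul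
      (he.continuousOn.comp hψ (hmaps ε hε).1)
  have h0 : (0 : ℝ) ∈ Ioo (-δ) δ := ⟨by linarith, hδ⟩
  have hcont' : ContinuousOn (fun s => 2 * η' s * e s + e' s * η s) (Icc 0 1) :=
    ((continuousOn_const.mul hηd).mul he.continuousOn).add (hed.mul hη.continuousOn)
  have key := intervalIntegral.hasDerivAt_integral_of_dominated_loc_of_deriv_le
    (μ := volume) (a := (0 : ℝ)) (b := 1) (x₀ := (0 : ℝ)) (s := Ioo (-δ) δ)
    (F := fun ε s => (1 + ε * η' s) ^ 2 * e (s + ε * η s))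
    (F' := fun ε s => 2 * (1 + ε * η' s) * η' s * e (s + ε * η s) +
      (1 + ε * η' s) ^ 2 * (e' (s + ε * η s) * η s))
    (bound := fun _ => 2 * (1 + δ * B') * B' * A + (1 + δ * B') ^ 2 * (A' * B))
    (Ioo_mem_nhds h0.1 h0.2) ?_ ?_ ?_ ?_ ?_ ?_
  · simpa using key.2
  · filter_upwards [Ioo_mem_nhds h0.1 h0.2] with ε hε
    rw [uIoc_of_le zero_le_one]
    exact ((hcont ε hε).mono Ioc_subset_Icc_self).aestronglyMeasurable measurableSet_Ioc
  · apply ContinuousOn.intervalIntegrable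
    rw [uIcc_of_le zero_le_one]
    exact hcont 0 h0
  · rw [uIoc_of_le zero_le_one]
    simpa using (hcont'.mono Ioc_subset_Icc_self).aestronglyMeasurable measurableSet_Ioc
  · refine Filter.Eventually.of_forall fun s hs ε hε => ?_
    rw [uIoc_of_le zero_le_one] at hs
    have hs' := Ioc_subset_Icc_self hs
    have hψ := (hmaps ε hε).1 s hs'
    have hB'₀ : 0 ≤ B' := (norm_nonneg _).trans (hB' s hs')
    have h₁ : ‖1 + ε * η' s‖ ≤ 1 + δ * B' := by
      refine (norm_add_le _ _).trans ?_
      rw [norm_one, norm_mul]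
      have : ‖ε‖ ≤ δ := (abs_lt.mpr hε).le
      have := hB' s hs'
      gcongr
    have h₂ := hA _ hψ
    have h₃ := hA' _ hψ
    have h₄ := hB s hs'
    have h₅ := hB' s hs'
    refine (norm_add_le _ _).trans ?_
    simp only [norm_mul, norm_pow]
    have h₆ : ‖(2 : ℝ)‖ = 2 := by norm_num
    rw [h₆]
    have h₇ : 0 ≤ 1 + δ * B' := by positivity
    have h₈ : 0 ≤ A' := (norm_nonneg _).trans h₃
    gcongr
  · exact intervalIntegrable_const
  -- At the end points `e` has only a one-sided derivative. Discarding the null set `{1}` leaves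
  -- interior `s`, which stay interior under the reparametrisation.
  · have hne : ∀ᵐ s : ℝ, s ≠ 1 := by simp [ae_iff]
    filter_upwards [hne] with s hs1 hs ε hε
    rw [uIoc_of_le zero_le_one] at hs
    have hψ := (hmaps ε hε).2 s ⟨hs.1, lt_of_le_of_ne hs.2 hs1⟩
    have hde : HasDerivAt e (e' (s + ε * η s)) (s + ε * η s) :=
      (he.hasDerivWithinAt_Icc (Ioo_subset_Icc_self hψ)).hasDerivAt (Icc_mem_nhds hψ.1 hψ.2)
    have hdψ : HasDerivAt (fun x : ℝ => s + x * η s) (η s) ε := by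
      simpa using ((hasDerivAt_id ε).mul_const (η s)).const_add s
    have hdp : HasDerivAt (fun x : ℝ => 1 + x * η' s) (η' s) ε := by
      simpa using ((hasDerivAt_id ε).mul_const (η' s)).const_add 1
    exact ((hdp.pow 2).mul (hde.comp ε hdψ)).congr_deriv (by simp)

end Calculus

/-! ### The covariant derivative along a curve -/

namespace SphereBundle

/-- The covariant derivative along `b`, in terms of fields with values in `ℝ³`. -/
noncomputable def ambientCovDeriv (b : ℝ → E3) (V : ℝ → AmbientL2) (s : ℝ) : AmbientL2 :=
  fieldProj (b s) (derivWithin V (Icc 0 1) s)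

theorem contDiffOn_ambientCovDeriv {b : ℝ → E3} {V : ℝ → AmbientL2}
    (hb : ContDiffOn ℝ ∞ b (Icc 0 1)) (hV : ContDiffOn ℝ ∞ V (Icc 0 1)) :
    ContDiffOn ℝ ∞ (ambientCovDeriv b V) (Icc 0 1) :=
  (contDiff_fieldProj.comp_contDiffOn hb).clm_apply (contDiffOn_derivWithin_Icc hV)

theorem fiberIncl_covDeriv_eq (β : ℝ → S2) (V : (s : ℝ) → Fiber (β s)) :
    (fun s => fiberIncl (β s) (covDeriv β V s)) =
      ambientCovDeriv (fun s => (β s : E3)) (fun s => fiberIncl (β s) (V s)) :=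
  funext fun s => fiberIncl_covDeriv β V s

/-- Metric compatibility of the covariant derivative. -/
theorem hasDerivWithinAt_inner_fiberIncl {β : ℝ → S2} {V W : (s : ℝ) → Fiber (β s)}
    (hV : ContDiffOn ℝ ∞ (fun s => fiberIncl (β s) (V s)) (Icc 0 1))
    (hW : ContDiffOn ℝ ∞ (fun s => fiberIncl (β s) (W s)) (Icc 0 1)) {s : ℝ}
    (hs : s ∈ Icc (0 : ℝ) 1) :
    HasDerivWithinAt
      (fun r => (inner ℝ (fiberIncl (β r) (V r)) (fiberIncl (β r) (W r)) : ℝ))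
      (inner ℝ (fiberIncl (β s) (V s)) (fiberIncl (β s) (covDeriv β W s)) +
        inner ℝ (fiberIncl (β s) (covDeriv β V s)) (fiberIncl (β s) (W s))) (Icc 0 1) s := by
  rw [fiberIncl_covDeriv, fiberIncl_covDeriv]
  exact hasDerivWithinAt_inner_of_proj (inner_fieldProj_left _) (hV.hasDerivWithinAt_Icc hs)
    (hW.hasDerivWithinAt_Icc hs) (fieldProj_fiberIncl _ _) (fieldProj_fiberIncl _ _)

theorem contDiffOn_covDeriv {β : ℝ → S2} {V : (s : ℝ) → Fiber (β s)}
    (hβ : ContDiffOn ℝ ∞ (fun s => (β s : E3)) (Icc 0 1))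
    (hV : ContDiffOn ℝ ∞ (fun s => fiberIncl (β s) (V s)) (Icc 0 1)) :
    ContDiffOn ℝ ∞ (fun s => fiberIncl (β s) (covDeriv β V s)) (Icc 0 1) := by
  rw [fiberIncl_covDeriv_eq]
  exact contDiffOn_ambientCovDeriv hβ hV

/-- Integration by parts for the covariant derivative, for a field vanishing at the end points. -/
theorem integral_inner_covDeriv {β : ℝ → S2} {V W : (s : ℝ) → Fiber (β s)}
    (hβ : ContDiffOn ℝ ∞ (fun s => (β s : E3)) (Icc 0 1))
    (hV : ContDiffOn ℝ ∞ (fun s => fiberIncl (β s) (V s)) (Icc 0 1))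
    (hW : ContDiffOn ℝ ∞ (fun s => fiberIncl (β s) (W s)) (Icc 0 1))
    (h₀ : W 0 = 0) (h₁ : W 1 = 0) :
    (∫ s in (0 : ℝ)..1,
        inner ℝ (fiberIncl (β s) (V s)) (fiberIncl (β s) (covDeriv β W s))) +
      ∫ s in (0 : ℝ)..1,
        inner ℝ (fiberIncl (β s) (covDeriv β V s)) (fiberIncl (β s) (W s)) = 0 := by
  have h := integral_derivWithin_eq_zero (hV.inner ℝ hW) (by simp [h₀]) (by simp [h₁])
  rw [← intervalIntegral.integral_add]
  · refine Eq.trans ?_ h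
    apply intervalIntegral.integral_congr
    intro s hs
    rw [uIcc_of_le zero_le_one] at hs
    exact ((hasDerivWithinAt_inner_fiberIncl hV hW hs).derivWithin
      (uniqueDiffOn_Icc zero_lt_one s hs)).symm
  · apply ContinuousOn.intervalIntegrable
    rw [uIcc_of_le zero_le_one]
    exact (hV.inner ℝ (contDiffOn_covDeriv hβ hW)).continuousOn
  · apply ContinuousOn.intervalIntegrable
    rw [uIcc_of_le zero_le_one]
    exact ((contDiffOn_covDeriv hβ hV).inner ℝ hW).continuousOn

/-! ### Vertical variations and covariant linearity -/

theorem IsSmoothPath.base {γ : ℝ → BundleC} (hγ : IsSmoothPath γ) :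
    ContDiffOn ℝ ∞ (fun s => (baseCurve γ s : E3)) (Icc 0 1) :=
  ContDiffOn.fst hγ

theorem IsSmoothPath.fiber {γ : ℝ → BundleC} (hγ : IsSmoothPath γ) :
    ContDiffOn ℝ ∞ (fun s => fiberIncl (baseCurve γ s) (fiberPart γ s)) (Icc 0 1) :=
  ContDiffOn.snd hγ

theorem isVariation_fiber {γ : ℝ → BundleC} (hγ : IsSmoothPath γ)
    {W : (s : ℝ) → Fiber (baseCurve γ s)}
    (hW : ContDiffOn ℝ ∞ (fun s => fiberIncl (baseCurve γ s) (W s)) (Icc 0 1))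
    (h₀ : W 0 = 0) (h₁ : W 1 = 0) :
    IsVariation γ 1 (fun ε s => ⟨(γ s).1, (γ s).2 + ε • W s⟩) where
  pos := one_pos
  smooth := by
    have hsnd : MapsTo (Prod.snd : ℝ × ℝ → ℝ) (Ioo (-1) 1 ×ˢ Icc 0 1) (Icc 0 1) :=
      fun x hx => hx.2
    have hV := (hγ.fiber.comp contDiffOn_snd hsnd).add
      (contDiffOn_fst.smul (hW.comp contDiffOn_snd hsnd))
    refine ((hγ.base.comp contDiffOn_snd hsnd).prodMk hV).congr fun x _ => ?_
    simp [ambient]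
  center s _ := by simp
  left ε _ := by simp [h₀]
  right ε _ := by simp [h₁]

/-- The first variation of the energy in the direction of a field `W` along the base curve. -/
theorem IsGeodesic.integral_inner_covDeriv_eq_zero {γ : ℝ → BundleC} (hγ : IsGeodesic γ)
    {W : (s : ℝ) → Fiber (baseCurve γ s)}
    (hW : ContDiffOn ℝ ∞ (fun s => fiberIncl (baseCurve γ s) (W s)) (Icc 0 1))
    (h₀ : W 0 = 0) (h₁ : W 1 = 0) :
    ∫ s in (0 : ℝ)..1,
      inner ℝ (fiberIncl (baseCurve γ s) (covDeriv (baseCurve γ) (fiberPart γ) s))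
        (fiberIncl (baseCurve γ s) (covDeriv (baseCurve γ) W s)) = (0 : ℝ) := by
  have hb := hγ.smooth.base
  have hQ := hγ.smooth.fiber
  have hcrit := hγ.critical 1 _ (isVariation_fiber hγ.smooth hW h₀ h₁)
  set X : ℝ → AmbientL2 := fun s =>
    fiberIncl (baseCurve γ s) (covDeriv (baseCurve γ) (fiberPart γ) s) with hX
  set Y : ℝ → AmbientL2 := fun s =>
    fiberIncl (baseCurve γ s) (covDeriv (baseCurve γ) W s) with hY
  set u : ℝ → ℝ := fun s => ‖tangentProj (baseCurve γ s)
    (derivWithin (fun r => (baseCurve γ r : E3)) (Icc 0 1) s)‖ ^ 2 with hu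
  have hXc : ContinuousOn X (Icc 0 1) := (contDiffOn_covDeriv hb hQ).continuousOn
  have hYc : ContinuousOn Y (Icc 0 1) := (contDiffOn_covDeriv hb hW).continuousOn
  have huc : ContinuousOn u (Icc 0 1) :=
    (((contDiff_tangentProj.comp_contDiffOn hb).clm_apply
      (contDiffOn_derivWithin_Icc hb)).continuousOn.norm).pow 2
  have hint : ∀ {f : ℝ → ℝ}, ContinuousOn f (Icc 0 1) → IntervalIntegrable f volume 0 1 := by
    intro f hf
    apply ContinuousOn.intervalIntegrable
    rwa [uIcc_of_le zero_le_one]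
  -- The base curve does not move, so `∇(q + εW) = ∇q + ε∇W` in the same fibre and the density is
  -- quadratic in `ε`.
  have henergy : ∀ ε : ℝ, energy (fun s => ⟨(γ s).1, (γ s).2 + ε • W s⟩) =
      (1 / 2) * ((∫ s in (0 : ℝ)..1, (u s + ‖X s‖ ^ 2)) +
        ε * (2 * ∫ s in (0 : ℝ)..1, (inner ℝ (X s) (Y s) : ℝ)) +
        ε ^ 2 * ∫ s in (0 : ℝ)..1, ‖Y s‖ ^ 2) := by
    intro ε
    rw [energy, ← intervalIntegral.integral_const_mul 2, ← intervalIntegral.integral_const_mul ε,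
      ← intervalIntegral.integral_const_mul (ε ^ 2), ← intervalIntegral.integral_add,
      ← intervalIntegral.integral_add]
    · congr 1
      apply intervalIntegral.integral_congr
      intro s hs
      rw [uIcc_of_le zero_le_one] at hs
      refine (metricC_velocity (fun s => ⟨(γ s).1, (γ s).2 + ε • W s⟩) s).trans ?_
      have hd : derivWithin (fun r => fiberIncl (γ r).1 ((γ r).2 + ε • W r)) (Icc 0 1) s =
          derivWithin (fun r => fiberIncl (γ r).1 (γ r).2) (Icc 0 1) s +
          ε • derivWithin (fun r => fiberIncl (γ r).1 (W r)) (Icc 0 1) s := by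
        simp only [map_add, map_smul]
        exact ((hQ.hasDerivWithinAt_Icc hs).add
          ((hW.hasDerivWithinAt_Icc hs).const_smul ε)).derivWithin
          (uniqueDiffOn_Icc zero_lt_one s hs)
      have hXY : fieldProj (γ s).1
          (derivWithin (fun r => fiberIncl (γ r).1 ((γ r).2 + ε • W r)) (Icc 0 1) s) =
          X s + ε • Y s := by
        rw [hd, map_add, map_smul, hX, hY]
        simp only [fiberIncl_covDeriv]
      rw [hXY, norm_add_sq_real, norm_smul, real_inner_smul_right, mul_pow, Real.norm_eq_abs,
        sq_abs]
      simp only [hu]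
      ring
    · exact hint ((huc.add (hXc.norm.pow 2)).add
        (continuousOn_const.mul (continuousOn_const.mul (hXc.inner hYc))))
    · exact hint (continuousOn_const.mul (hYc.norm.pow 2))
    · exact hint (huc.add (hXc.norm.pow 2))
    · exact hint (continuousOn_const.mul (continuousOn_const.mul (hXc.inner hYc)))
  simp only [henergy] at hcrit
  set I₀ := ∫ s in (0 : ℝ)..1, (u s + ‖X s‖ ^ 2)
  set I₁ := ∫ s in (0 : ℝ)..1, (inner ℝ (X s) (Y s) : ℝ)
  set I₂ := ∫ s in (0 : ℝ)..1, ‖Y s‖ ^ 2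
  have hpoly : HasDerivAt (fun ε : ℝ => (1 / 2) * (I₀ + ε * (2 * I₁) + ε ^ 2 * I₂)) I₁ 0 := by
    have h := ((((hasDerivAt_id (0 : ℝ)).mul_const (2 * I₁)).const_add I₀).add
      (((hasDerivAt_id (0 : ℝ)).pow 2).mul_const I₂)).const_mul (1 / 2)
    exact h.congr_deriv (by simp)
  exact hpoly.unique hcrit

theorem IsGeodesic.covDeriv_covDeriv_eq_zero {γ : ℝ → BundleC} (hγ : IsGeodesic γ) :
    ∀ s ∈ Icc (0 : ℝ) 1,
      covDeriv (baseCurve γ) (covDeriv (baseCurve γ) (fiberPart γ)) s = 0 := by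
  have hb := hγ.smooth.base
  have hX := contDiffOn_covDeriv hb hγ.smooth.fiber
  have hA := contDiffOn_covDeriv hb hX
  -- The test field is `s(1-s)∇∇q`: the weight fixes the end points and is positive between them.
  have hW : ContDiffOn ℝ ∞ (fun s => fiberIncl (baseCurve γ s) ((s * (1 - s)) •
      covDeriv (baseCurve γ) (covDeriv (baseCurve γ) (fiberPart γ)) s)) (Icc 0 1) := by
    simp only [map_smul]
    exact (contDiff_id.mul (contDiff_const.sub contDiff_id)).contDiffOn.smul hA
  have h₁ := hγ.integral_inner_covDeriv_eq_zero hW (by simp) (by simp)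
  have h₂ := integral_inner_covDeriv hb hX hW (by simp) (by simp)
  rw [h₁, zero_add] at h₂
  simp only [map_smul, real_inner_smul_right, real_inner_self_eq_norm_sq] at h₂
  intro s hs
  apply fiberIncl_injective
  rw [map_zero]
  exact eq_zero_of_integral_bump_mul_sq hA.continuousOn h₂ s hs

/-! ### Reparametrisations and constancy of the total speed -/

theorem isVariation_reparam {γ : ℝ → BundleC} (hγ : IsSmoothPath γ) {η : ℝ → ℝ}
    (hη : ContDiffOn ℝ ∞ η (Icc 0 1)) (h₀ : η 0 = 0) (h₁ : η 1 = 0) {δ : ℝ} (hδ : 0 < δ)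
    (hmaps : ∀ ε ∈ Ioo (-δ) δ, ∀ s ∈ Icc (0 : ℝ) 1, s + ε * η s ∈ Icc (0 : ℝ) 1) :
    IsVariation γ δ (fun ε s => γ (s + ε * η s)) where
  pos := hδ
  smooth := by
    have hψ : ContDiffOn ℝ ∞ (fun x : ℝ × ℝ => x.2 + x.1 * η x.2) (Ioo (-δ) δ ×ˢ Icc 0 1) :=
      contDiffOn_snd.add (contDiffOn_fst.mul (hη.comp contDiffOn_snd fun x hx => hx.2))
    exact ContDiffOn.comp (g := fun s => ambient (γ s)) hγ hψ
      fun x hx => hmaps x.1 hx.1 x.2 hx.2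
  center s _ := by simp
  left ε _ := by simp [h₀]
  right ε _ := by simp [h₁]

theorem derivWithin_comp_reparam {F : Type*} [NormedAddCommGroup F] [NormedSpace ℝ F]
    {f : ℝ → F} (hf : ContDiffOn ℝ ∞ f (Icc 0 1)) {η : ℝ → ℝ}
    (hη : ContDiffOn ℝ ∞ η (Icc 0 1)) {ε : ℝ}
    (hmaps : MapsTo (fun s => s + ε * η s) (Icc (0 : ℝ) 1) (Icc 0 1)) {s : ℝ}
    (hs : s ∈ Icc (0 : ℝ) 1) :
    derivWithin (fun r => f (r + ε * η r)) (Icc 0 1) s =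
      (1 + ε * derivWithin η (Icc 0 1) s) • derivWithin f (Icc 0 1) (s + ε * η s) :=
  ((hf.hasDerivWithinAt_Icc (hmaps hs)).scomp s
    ((hasDerivWithinAt_id s _).add ((hη.hasDerivWithinAt_Icc hs).const_mul ε))
    hmaps).derivWithin (uniqueDiffOn_Icc zero_lt_one s hs)

/-- The total speed of a geodesic is constant. -/
theorem IsGeodesic.metricC_velocity_eq {γ : ℝ → BundleC} (hγ : IsGeodesic γ) {s : ℝ}
    (hs : s ∈ Icc (0 : ℝ) 1) :
    metricC (γ s) (velocity γ s) (velocity γ s) = metricC (γ 0) (velocity γ 0) (velocity γ 0) := by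
  have hb := hγ.smooth.base
  have hQ := hγ.smooth.fiber
  set e : ℝ → ℝ := fun s => metricC (γ s) (velocity γ s) (velocity γ s) with he_def
  have he : ContDiffOn ℝ ∞ e (Icc 0 1) := by
    simp only [he_def, metricC_velocity]
    exact (((contDiff_tangentProj.comp_contDiffOn hb).clm_apply
      (contDiffOn_derivWithin_Icc hb)).norm_sq ℝ).add
      ((contDiffOn_ambientCovDeriv hb hQ).norm_sq ℝ)
  have he' := contDiffOn_derivWithin_Icc he
  -- Chosen so that `∫ e'η`, to which the first variation reduces, is a weighted integral of `e'²`.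
  set η : ℝ → ℝ := fun s => s * (1 - s) * derivWithin e (Icc 0 1) s with hη_def
  have hη : ContDiffOn ℝ ∞ η (Icc 0 1) :=
    (contDiff_id.mul (contDiff_const.sub contDiff_id)).contDiffOn.mul he'
  have hη₀ : η 0 = 0 := by simp [hη_def]
  have hη₁ : η 1 = 0 := by simp [hη_def]
  obtain ⟨δ, hδ, hmaps⟩ := exists_reparam_mapsTo he'.continuousOn
  have hcrit := hγ.critical δ _
    (isVariation_reparam hγ.smooth hη hη₀ hη₁ hδ fun ε hε => (hmaps ε hε).1)
  -- By the chain rule both components of the velocity are multiplied by `1 + εη'`.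
  have henergy : ∀ ε ∈ Ioo (-δ) δ, energy (fun s => γ (s + ε * η s)) =
      (1 / 2) * ∫ s in (0 : ℝ)..1,
        (1 + ε * derivWithin η (Icc 0 1) s) ^ 2 * e (s + ε * η s) := by
    intro ε hε
    rw [energy]
    congr 1
    apply intervalIntegral.integral_congr
    intro s hs
    rw [uIcc_of_le zero_le_one] at hs
    refine (metricC_velocity (fun s => γ (s + ε * η s)) s).trans ?_
    simp only [he_def]
    rw [metricC_velocity, derivWithin_comp_reparam hb hη (hmaps ε hε).1 hs,
      derivWithin_comp_reparam hQ hη (hmaps ε hε).1 hs]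
    simp only [map_smul, norm_smul, mul_pow, Real.norm_eq_abs, sq_abs]
    ring
  have hder := (hasDerivAt_integral_reparam he hη hδ hmaps).const_mul (1 / 2)
  have hzero := (hcrit.congr_of_eventuallyEq (Filter.eventuallyEq_of_mem
    (Ioo_mem_nhds (neg_lt_zero.mpr hδ) hδ) fun ε hε => (henergy ε hε).symm)).unique hder
  have hparts := integral_derivWithin_eq_zero (hη.mul he) (by simp [hη₀]) (by simp [hη₁])
  have hparts' : ∫ s in (0 : ℝ)..1,
      (derivWithin η (Icc 0 1) s * e s + derivWithin e (Icc 0 1) s * η s) = 0 := by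
    refine Eq.trans ?_ hparts
    apply intervalIntegral.integral_congr
    intro s hs
    rw [uIcc_of_le zero_le_one] at hs
    refine Eq.trans ?_ (((hη.hasDerivWithinAt_Icc hs).mul
      (he.hasDerivWithinAt_Icc hs)).derivWithin (uniqueDiffOn_Icc zero_lt_one s hs)).symm
    ring
  have hint : ∀ {f : ℝ → ℝ}, ContinuousOn f (Icc 0 1) → IntervalIntegrable f volume 0 1 := by
    intro f hf
    apply ContinuousOn.intervalIntegrable
    rwa [uIcc_of_le zero_le_one]
  have hηe := (contDiffOn_derivWithin_Icc hη).mul he |>.continuousOn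
  have heη := (he'.mul hη).continuousOn
  have hsq : ∫ s in (0 : ℝ)..1, s * (1 - s) * ‖derivWithin e (Icc 0 1) s‖ ^ 2 = 0 := by
    have h₁ : ∫ s in (0 : ℝ)..1, (2 * derivWithin η (Icc 0 1) s * e s +
        derivWithin e (Icc 0 1) s * η s) = 0 := by linarith
    -- This is `e'η = 2(ηe)' - (2η'e + e'η)`; both terms on the right have zero integral.
    have h₂ : (fun s => s * (1 - s) * ‖derivWithin e (Icc 0 1) s‖ ^ 2) = fun s =>
        2 * (derivWithin η (Icc 0 1) s * e s + derivWithin e (Icc 0 1) s * η s) -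
        (2 * derivWithin η (Icc 0 1) s * e s + derivWithin e (Icc 0 1) s * η s) := by
      funext s
      rw [Real.norm_eq_abs, sq_abs]
      simp only [hη_def]
      ring
    rw [h₂, intervalIntegral.integral_sub, intervalIntegral.integral_const_mul, hparts', h₁]
    · simp
    · exact (hint (hηe.add heη)).const_mul 2
    · simp only [mul_assoc]
      exact hint ((continuousOn_const.mul hηe).add heη)
  exact eq_of_derivWithin_Icc_eq_zero (he.differentiableOn (by simp))
    (eq_zero_of_integral_bump_mul_sq he'.continuousOn hsq) hs

/-! ### Constant speed of the base curve -/

theorem tangentProj_derivWithin {β : ℝ → S2}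
    (hβ : ContDiffOn ℝ ∞ (fun s => (β s : E3)) (Icc 0 1)) {s : ℝ} (hs : s ∈ Icc (0 : ℝ) 1) :
    tangentProj (β s) (derivWithin (fun r => (β r : E3)) (Icc 0 1) s) =
      derivWithin (fun r => (β r : E3)) (Icc 0 1) s := by
  have h := ((hβ.hasDerivWithinAt_Icc hs).inner ℝ (hβ.hasDerivWithinAt_Icc hs)).derivWithin
    (uniqueDiffOn_Icc zero_lt_one s hs)
  simp only [real_inner_self_eq_norm_sq, norm_eq_of_mem_sphere, one_pow,
    derivWithin_fun_const, Pi.zero_apply] at h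
  rw [real_inner_comm (β s : E3)] at h
  have h' : inner ℝ (β s : E3) (derivWithin (fun r => (β r : E3)) (Icc 0 1) s) = 0 := by
    linarith
  rw [tangentProj_apply, h', zero_smul, sub_zero]

/-- The derivative of `‖∇q‖²` is `2⟨∇q, ∇∇q⟩`, and `∇∇q = 0`. -/
theorem IsGeodesic.norm_covDeriv_eq {γ : ℝ → BundleC} (hγ : IsGeodesic γ) {s : ℝ}
    (hs : s ∈ Icc (0 : ℝ) 1) :
    ‖fiberIncl (baseCurve γ s) (covDeriv (baseCurve γ) (fiberPart γ) s)‖ ^ 2 =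
      ‖fiberIncl (baseCurve γ 0) (covDeriv (baseCurve γ) (fiberPart γ) 0)‖ ^ 2 := by
  have hX := contDiffOn_covDeriv hγ.smooth.base hγ.smooth.fiber
  refine eq_of_derivWithin_Icc_eq_zero (f := fun s =>
    ‖fiberIncl (baseCurve γ s) (covDeriv (baseCurve γ) (fiberPart γ) s)‖ ^ 2)
    ((hX.norm_sq ℝ).differentiableOn (by simp)) (fun r hr => ?_) hs
  have h := (hasDerivWithinAt_inner_fiberIncl hX hX hr).derivWithin
    (uniqueDiffOn_Icc zero_lt_one r hr)
  simpa [hγ.covDeriv_covDeriv_eq_zero r hr, real_inner_self_eq_norm_sq] using h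

theorem IsGeodesic.norm_derivWithin_base_eq {γ : ℝ → BundleC} (hγ : IsGeodesic γ) {s : ℝ}
    (hs : s ∈ Icc (0 : ℝ) 1) :
    ‖derivWithin (fun r => (baseCurve γ r : E3)) (Icc 0 1) s‖ =
      ‖derivWithin (fun r => (baseCurve γ r : E3)) (Icc 0 1) 0‖ := by
  have h0 : (0 : ℝ) ∈ Icc (0 : ℝ) 1 := by simp
  have h₁ := hγ.metricC_velocity_eq hs
  have h₂ := hγ.norm_covDeriv_eq hs
  rw [metricC_velocity, metricC_velocity, tangentProj_derivWithin hγ.smooth.base hs,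
    tangentProj_derivWithin hγ.smooth.base h0] at h₁
  rw [fiberIncl_covDeriv, fiberIncl_covDeriv] at h₂
  rw [← sq_eq_sq₀ (norm_nonneg _) (norm_nonneg _)]
  linarith

end SphereBundle

theorem mainTheorem2 (γ : ℝ → SphereBundle.BundleC) (hγ : SphereBundle.IsGeodesic γ) :
    (∃ c : ℝ, ∀ s ∈ Set.Icc (0 : ℝ) 1,
      ‖derivWithin (fun r => (SphereBundle.baseCurve γ r : SphereBundle.E3)) (Set.Icc 0 1) s‖ = c) ∧
    (∀ s ∈ Set.Icc (0 : ℝ) 1,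
      SphereBundle.covDeriv (SphereBundle.baseCurve γ)
        (SphereBundle.covDeriv (SphereBundle.baseCurve γ) (SphereBundle.fiberPart γ)) s = 0) :=
  ⟨⟨_, fun _ hs => hγ.norm_derivWithin_base_eq hs⟩, hγ.covDeriv_covDeriv_eq_zero⟩
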